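/- Let $E$ be a Polish space, equipped with its Borel $\sigma$-field $\mathcal E$ and with a partial order $\preceq$ that is closed, i.e. $\{(x,x') : x \preceq x'\}$ is closed in $E \times E$. For an index set $J$ let $E^J$ carry the product $\sigma$-field and the coordinatewise partial order, and call a function $f : E^J \to \mathbb R$ non-decreasing if $x_j \preceq y_j$ for all $j \in J$ implies $f(x) \le f(y)$. A family $X = (X_i)_{i \in I}$ of random elements of $E$ defined on a common probability space, with $X_J := (X_i)_{i\in J}$ for $J \subset I$, is called - *negatively associated* if $\mathbb E[f(X_J)\,g(X_{I\setminus J})] \le \mathbb E[f(X_J)]\,\mathbb E[g(X_{I \setminus J})]$ for all $J \subset I$ and all bounded measurable non-decreasing $f : E^J \to \mathbb R$ and $g : E^{I \setminus J} \to \mathbb R$; - *positively associated* if $\mathbb E[f(X_J)\,g(X_J)] \ge \mathbb E[f(X_J)]\,\mathbb E[g(X_J)]$ for all $J \subset I$ and all bounded measurable non-decreasing $f, g : E^J \to \mathbb R$. **Theorem.** Let $I$ be countable (finite or infinite) and let $X = (X_i)_{i \in I}$ be a family of random elements of $E$ defined on a common probability space. 1. If for every finite $J \subset I$ the subfamily $X_J$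 is negatively associated, then $X$ is negatively associated. 2. If for every finite $J \subset I$ the subfamily $X_J$ is positively associated, then $X$ is positively associated. -/

import Mathlib

open MeasureTheory

/-- A family `X = (X i)` of random elements of an ordered
measurable space `E` is *negatively associated* under `μ` if
`𝔼[f(X_J) g(X_{Jᶜ})] ≤ 𝔼[f(X_J)] 𝔼[g(X_{Jᶜ})]` for every set `J` of indices and all bounded measurable
functions `f` on `E^J` and `g` on `E^{Jᶜ}` that are non-decreasing for the coordinatewise order.
The powers of `E` carry the product `σ`-field and the product order. -/
def NegativelyAssociated {ι Ω E : Type*} [MeasurableSpace Ω] [MeasurableSpace E] [PartialOrder E]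
    (μ : Measure Ω) (X : ι → Ω → E) : Prop :=
  ∀ (J : Set ι) (f : (J → E) → ℝ) (g : ((Jᶜ : Set ι) → E) → ℝ),
    Measurable f → Monotone f → (∃ C : ℝ, ∀ x, |f x| ≤ C) →
    Measurable g → Monotone g → (∃ C : ℝ, ∀ x, |g x| ≤ C) →
      ∫ ω, f (fun j => X j ω) * g (fun k => X k ω) ∂μ
        ≤ (∫ ω, f (fun j => X j ω) ∂μ) * ∫ ω, g (fun k => X k ω) ∂μ

/-- A family `X = (X i)` of random elements of an ordered measurable space `E` is
*positively associated* under `μ` if `𝔼[f(X_J) g(X_J)] ≥ 𝔼[f(X_J)] 𝔼[g(X_J)]` for every set `J` of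
indices and all bounded measurable functions `f`, `g` on `E^J` that are non-decreasing for the
coordinatewise order. -/
def PositivelyAssociated {ι Ω E : Type*} [MeasurableSpace Ω] [MeasurableSpace E] [PartialOrder E]
    (μ : Measure Ω) (X : ι → Ω → E) : Prop :=
  ∀ (J : Set ι) (f g : (J → E) → ℝ),
    Measurable f → Monotone f → (∃ C : ℝ, ∀ x, |f x| ≤ C) →
    Measurable g → Monotone g → (∃ C : ℝ, ∀ x, |g x| ≤ C) →
      (∫ ω, f (fun j => X j ω) ∂μ) * ∫ ω, g (fun j => X j ω) ∂μ
        ≤ ∫ ω, f (fun j => X j ω) * g (fun j => X j ω) ∂μ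

/-!
Association inequalities bound the covariance of two bounded monotone functions of the family, and
this covariance is continuous in `L¹` on bounded functions (`abs_cov_sub_cov_le`). Hence it
suffices to approximate a bounded measurable monotone function on a countable power `E^J`, in `L¹`
of the law of the family, by bounded *monotone* functions of finitely many coordinates. Conditional
expectations would lose the monotonicity; instead the order and the topology are used together.

For the indicator of a measurable upper set `A`, inner regularity of the law on the Polish space
`E^J` gives a compact `K ⊆ A` of almost full measure in `A`. Its upper closure `↑K` still lies in
`A`, and by compactness of `K` and closedness of the order it is the decreasing intersection of the
cylinders over the upper closures of the finite-dimensional projections of `K`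
(`IsCompact.iInter_restrict_preimage_upperClosure`), which are closed upper sets themselves. So one
of these cylinders is close to `A` in measure
(`exists_isUpperSet_symmDiff_restrict_preimage_le`). A general function is, up to a small uniform
error, a nonnegative combination of indicators of its superlevel sets plus a constant
(`exists_monotone_restrict_integral_abs_sub_le`).
-/

open Set Filter Topology

/-! ### Finite-dimensional approximation of upper sets -/

theorem IsCompact.isClosed_upperClosure {α : Type*} [TopologicalSpace α] [PartialOrder α]
    [OrderClosedTopology α] {K : Set α} (hK : IsCompact K) :
    IsClosed (upperClosure K : Set α) := by
  have : CompactSpace K := isCompact_iff_compactSpace.mp hK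
  have hc : IsClosed {p : K × α | (p.1 : α) ≤ p.2} :=
    isClosed_le (continuous_subtype_val.comp continuous_fst) continuous_snd
  convert isClosedMap_snd_of_compactSpace _ hc using 1
  ext x
  simp

/-- The upper closure of a compact subset of a power is cut out by finitely many coordinates at a
time: if `x` dominates a point of `K` on each finite set of coordinates, then by compactness it
dominates a single point of `K` everywhere. -/
theorem IsCompact.iInter_restrict_preimage_upperClosure {J E : Type*} [TopologicalSpace E]
    [PartialOrder E] [OrderClosedTopology E] {K : Set (J → E)} (hK : IsCompact K) :
    ⋂ F : Finset J, F.restrict ⁻¹' (upperClosure (F.restrict '' K) : Set (F → E))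
      = (upperClosure K : Set (J → E)) := by
  ext x
  simp only [mem_iInter, mem_preimage, SetLike.mem_coe, mem_upperClosure, exists_mem_image]
  constructor
  · intro h
    obtain ⟨k, hkK, hk⟩ := hK.inter_iInter_nonempty (fun j => {k : J → E | k j ≤ x j})
      (fun j => isClosed_le (continuous_apply j) continuous_const) (fun F => by
        obtain ⟨k, hk, hle⟩ := h F
        exact ⟨k, hk, by simpa using fun j hj => hle ⟨j, hj⟩⟩)
    exact ⟨k, hkK, fun j => mem_iInter.mp hk j⟩
  · rintro ⟨k, hk, hle⟩ F
    exact ⟨k, hk, fun j => hle j⟩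

/-- Measurable upper sets of a countable power are approximable in measure by finite-dimensional
measurable upper sets: pass to the upper closure of a large compact subset, and project it to
finitely many coordinates. -/
theorem exists_isUpperSet_symmDiff_restrict_preimage_le {J E : Type*} [Countable J]
    [TopologicalSpace E] [PolishSpace E] [MeasurableSpace E] [BorelSpace E]
    [PartialOrder E] [OrderClosedTopology E] (P : Measure (J → E)) [IsFiniteMeasure P]
    {A : Set (J → E)} (hA : MeasurableSet A) (hU : IsUpperSet A) {ε : ℝ} (hε : 0 < ε) :
    ∃ (F : Finset J) (B : Set (F → E)), MeasurableSet B ∧ IsUpperSet B ∧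
      P.real (symmDiff A (F.restrict ⁻¹' B)) ≤ ε := by
  have hε' : ENNReal.ofReal (ε / 2) ≠ 0 := by simpa using hε
  obtain ⟨K, hKA, hK, hPK⟩ := hA.exists_isCompact_sdiff_lt (measure_ne_top P A) hε'
  have hKU : (upperClosure K : Set (J → E)) ⊆ A := upperClosure_min hKA hU
  have hB (F : Finset J) :
      MeasurableSet (upperClosure (F.restrict '' K) : Set (F → E)) :=
    (hK.image (by unfold Finset.restrict; fun_prop)).isClosed_upperClosure.measurableSet
  let s (F : Finset J) : Set (J → E) :=
    F.restrict ⁻¹' (upperClosure (F.restrict '' K) : Set (F → E)) \ upperClosure K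
  have hs : Tendsto (P ∘ s) atTop (𝓝 (P (⋂ F, s F))) := by
    refine tendsto_measure_iInter_atTop (fun F => ?_) ?_ ⟨∅, measure_ne_top P _⟩
    · exact ((F.measurable_restrict (hB F)).diff
        hK.isClosed_upperClosure.measurableSet).nullMeasurableSet
    · refine fun F G hFG => sdiff_subset_sdiff_left fun x hx => ?_
      simp only [mem_preimage, SetLike.mem_coe, mem_upperClosure, exists_mem_image] at hx ⊢
      obtain ⟨k, hk, hle⟩ := hx
      exact ⟨k, hk, fun j => hle ⟨j, hFG j.2⟩⟩
  have h0 : ⋂ F, s F = ∅ := by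
    refine eq_empty_of_forall_notMem fun x hx => ?_
    rw [mem_iInter] at hx
    refine (hx ∅).2 ?_
    rw [← hK.iInter_restrict_preimage_upperClosure]
    exact mem_iInter.mpr fun F => (hx F).1
  rw [h0, measure_empty] at hs
  obtain ⟨F, hF⟩ := (hs.eventually_lt_const (pos_iff_ne_zero.mpr hε')).exists
  refine ⟨F, _, hB F, (upperClosure _).upper, ?_⟩
  have hsub : symmDiff A (F.restrict ⁻¹' (upperClosure (F.restrict '' K) : Set (F → E)))
      ⊆ (A \ K) ∪ s F := by
    rintro x (⟨hxA, hx⟩ | ⟨hx, hxA⟩)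
    · exact Or.inl ⟨hxA, fun hxK => hx (subset_upperClosure (mem_image_of_mem _ hxK))⟩
    · exact Or.inr ⟨hx, fun h => hxA (hKU h)⟩
  refine ENNReal.toReal_le_of_le_ofReal hε.le ?_
  calc P _ ≤ P (A \ K) + P (s F) := (measure_mono hsub).trans (measure_union_le _ _)
    _ ≤ ENNReal.ofReal (ε / 2) + ENNReal.ofReal (ε / 2) := add_le_add hPK.le hF.le
    _ = ENNReal.ofReal ε := by rw [← ENNReal.ofReal_add (by positivity) (by positivity), add_halves]

/-! ### Finite-dimensional approximation of monotone functions -/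

/-- Layer-cake discretization: the number of integer levels below `t` recovers `t` up to `1`. -/
theorem abs_sub_sum_ite_succ_le {n : ℕ} {t : ℝ} (h0 : 0 ≤ t) (hn : t ≤ n) :
    |t - ∑ k ∈ Finset.range n, if (k : ℝ) + 1 ≤ t then (1 : ℝ) else 0| ≤ 1 := by
  have : (Finset.range n).filter (fun k : ℕ => (k : ℝ) + 1 ≤ t) = Finset.range ⌊t⌋₊ := by
    ext k
    have h1 : (k : ℝ) + 1 ≤ t ↔ k + 1 ≤ ⌊t⌋₊ := by
      rw [Nat.le_floor_iff h0]; push_cast; rfl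
    have h2 : ⌊t⌋₊ ≤ n := Nat.floor_le_of_le hn
    simp only [Finset.mem_filter, Finset.mem_range, h1]
    omega
  rw [← Finset.sum_filter, this, Finset.sum_const, Finset.card_range, nsmul_one, abs_le]
  constructor <;> linarith [Nat.floor_le h0, Nat.lt_floor_add_one t]

/-- A bounded measurable monotone function on a countable power is approximable in `L¹` by bounded
measurable monotone functions of finitely many coordinates, with the same bound. -/
theorem exists_monotone_restrict_integral_abs_sub_le {J E : Type*} [Countable J]
    [TopologicalSpace E] [PolishSpace E] [MeasurableSpace E] [BorelSpace E]
    [PartialOrder E] [OrderClosedTopology E] (P : Measure (J → E)) [IsProbabilityMeasure P]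
    {f : (J → E) → ℝ} (hf : Measurable f) (hmono : Monotone f) {C : ℝ} (hC : 0 < C)
    (hfC : ∀ x, |f x| ≤ C) {ε : ℝ} (hε : 0 < ε) :
    ∃ (F : Finset J) (h : (F → E) → ℝ), Measurable h ∧ Monotone h ∧ (∀ y, |h y| ≤ C) ∧
      ∫ x, |f x - h (F.restrict x)| ∂P ≤ ε := by
  classical
  -- `n` levels at distance `δ` cost `δ` by discretization, and `n * δ * η = 2 * C * η` by
  -- approximation of the level sets up to `η`.
  obtain ⟨n, hn⟩ := exists_nat_gt (4 * C / ε)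
  have hn0 : (0 : ℝ) < n := lt_trans (by positivity) hn
  set δ : ℝ := 2 * C / n with hδ
  have hδ0 : 0 < δ := by positivity
  have hnδ : n * δ = 2 * C := by rw [hδ]; field_simp
  have hδε : δ ≤ ε / 2 := by
    rw [div_lt_iff₀ hε] at hn
    rw [hδ, div_le_iff₀ hn0]; linarith
  let A (k : ℕ) : Set (J → E) := {x | (k : ℝ) + 1 ≤ (f x + C) / δ}
  have hA (k : ℕ) : MeasurableSet (A k) :=
    measurableSet_le measurable_const ((hf.add_const C).div_const δ)
  have hAU (k : ℕ) : IsUpperSet (A k) := fun x y hxy hx =>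
    le_trans (mem_ofPred_eq ▸ hx) (by have := hmono hxy; gcongr)
  choose F B hB hBU hAB using fun k => exists_isUpperSet_symmDiff_restrict_preimage_le P (hA k)
    (hAU k) (ε := ε / (4 * C)) (by positivity)
  let T : Finset J := (Finset.range n).biUnion F
  have hT (k : ℕ) (hk : k ∈ Finset.range n) : F k ⊆ T := Finset.subset_biUnion_of_mem F hk
  -- `B' k` is the cylinder over `B k` in the common coordinate set `T`.
  let B' (k : ℕ) : Set (T → E) :=
    ⋃ hk : k ∈ Finset.range n, Finset.restrict₂ (π := fun _ => E) (hT k hk) ⁻¹' B k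
  have hB' (k : ℕ) : MeasurableSet (B' k) :=
    MeasurableSet.iUnion fun hk =>
      Finset.measurable_restrict₂ (X := fun _ => E) (hT k hk) (hB k)
  have hB'U (k : ℕ) : IsUpperSet (B' k) :=
    isUpperSet_iUnion fun hk x y hxy hx => hBU k (fun j => hxy _) hx
  have hB'mem (k : ℕ) (hk : k ∈ Finset.range n) (x : J → E) :
      T.restrict x ∈ B' k ↔ (F k).restrict x ∈ B k :=
    mem_iUnion.trans ⟨fun ⟨_, h⟩ => h, fun h => ⟨hk, h⟩⟩
  refine ⟨T, fun y => δ * (∑ k ∈ Finset.range n, (B' k).indicator (fun _ => (1 : ℝ)) y) - C, ?_, ?_, ?_, ?_⟩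
  · exact ((Finset.measurable_sum _ fun k _ => measurable_const.indicator (hB' k)).const_mul
      δ).sub_const C
  · intro y z hyz
    dsimp only
    gcongr with k hk
    by_cases hy : y ∈ B' k
    · simp [hy, hB'U k hyz hy]
    · simpa [hy] using indicator_nonneg (fun _ _ => zero_le_one) z
  · intro y
    have h1 : ∑ k ∈ Finset.range n, (B' k).indicator (fun _ => (1 : ℝ)) y ≤ n := by
      simpa using Finset.sum_le_card_nsmul (Finset.range n)
        (fun k => (B' k).indicator (fun _ => (1 : ℝ)) y) 1
        (fun k _ => indicator_le_self' (fun _ _ => zero_le_one) y)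
    have h0 : 0 ≤ ∑ k ∈ Finset.range n, (B' k).indicator (fun _ => (1 : ℝ)) y :=
      Finset.sum_nonneg fun k _ => indicator_nonneg (fun _ _ => zero_le_one) y
    have := mul_le_mul_of_nonneg_left h1 hδ0.le
    rw [abs_le]
    constructor <;> nlinarith
  · have hS (k : ℕ) : MeasurableSet (symmDiff (A k) ((F k).restrict ⁻¹' B k)) :=
      (hA k).symmDiff ((F k).measurable_restrict (hB k))
    have hint (k : ℕ) : Integrable
        ((symmDiff (A k) ((F k).restrict ⁻¹' B k)).indicator (fun _ => (1 : ℝ))) P :=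
      (integrable_const (1 : ℝ)).indicator (hS k)
    have hpt (x : J → E) :
        |f x - (δ * (∑ k ∈ Finset.range n, (B' k).indicator (fun _ => (1 : ℝ)) (T.restrict x)) - C)| ≤
          δ + δ * ∑ k ∈ Finset.range n,
            (symmDiff (A k) ((F k).restrict ⁻¹' B k)).indicator (fun _ => (1 : ℝ)) x := by
      obtain ⟨hl, hu⟩ := abs_le.mp (hfC x)
      have h1 := abs_sub_sum_ite_succ_le (n := n) (t := (f x + C) / δ)
        (div_nonneg (by linarith) hδ0.le) (by rw [div_le_iff₀ hδ0, hnδ]; linarith)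
      have h2 : |(∑ k ∈ Finset.range n, if (k : ℝ) + 1 ≤ (f x + C) / δ then (1 : ℝ) else 0)
          - ∑ k ∈ Finset.range n, (B' k).indicator (fun _ => (1 : ℝ)) (T.restrict x)| ≤
          ∑ k ∈ Finset.range n,
            (symmDiff (A k) ((F k).restrict ⁻¹' B k)).indicator (fun _ => (1 : ℝ)) x := by
        rw [← Finset.sum_sub_distrib]
        refine (Finset.abs_sum_le_sum_abs _ _).trans (Finset.sum_le_sum fun k hk => ?_)
        by_cases ha : (k : ℝ) + 1 ≤ (f x + C) / δ <;> by_cases hb : (F k).restrict x ∈ B k <;>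
          simp [indicator, hB'mem k hk, mem_symmDiff, A, ha, hb]
      have h3 := (abs_sub_le _ _ _).trans (add_le_add h1 h2)
      have h4 (a : ℝ) : f x - (δ * a - C) = δ * ((f x + C) / δ - a) := by
        field_simp; ring
      rw [h4, abs_mul, abs_of_pos hδ0, ← mul_one_add]
      gcongr
    calc _ ≤ ∫ x, δ + δ * ∑ k ∈ Finset.range n,
            (symmDiff (A k) ((F k).restrict ⁻¹' B k)).indicator (fun _ => (1 : ℝ)) x ∂P :=
          integral_mono_of_nonneg (ae_of_all _ fun x => abs_nonneg _)
            ((integrable_const δ).add ((integrable_finsetSum _ fun k _ => hint k).const_mul δ))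
            (ae_of_all _ hpt)
      _ = δ + δ * ∑ k ∈ Finset.range n, P.real (symmDiff (A k) ((F k).restrict ⁻¹' B k)) := by
          rw [integral_add (integrable_const δ)
            ((integrable_finsetSum _ fun k _ => hint k).const_mul δ), integral_const_mul,
            integral_finsetSum _ fun k _ => hint k]
          simp [integral_indicator_const (1 : ℝ) (hS _)]
      _ ≤ δ + δ * (n * (ε / (4 * C))) := by
          gcongr
          simpa using Finset.sum_le_card_nsmul (Finset.range n) _ _ fun k _ => hAB k
      _ = δ + ε / 2 := by
          rw [← mul_assoc, mul_comm δ, hnδ]; field_simp; ring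
      _ ≤ ε := by linarith

/-! ### Stability of covariances and passage to the whole family -/

/-- The covariance of functions bounded by `C` is `L¹`-continuous in both arguments. -/
theorem abs_cov_sub_cov_le {Ω : Type*} [MeasurableSpace Ω] (μ : Measure Ω) [IsProbabilityMeasure μ]
    {u v u' v' : Ω → ℝ} (hu : Measurable u) (hv : Measurable v) (hu' : Measurable u')
    (hv' : Measurable v') {C ε : ℝ} (huC : ∀ ω, |u ω| ≤ C) (hvC : ∀ ω, |v ω| ≤ C)
    (huC' : ∀ ω, |u' ω| ≤ C) (hvC' : ∀ ω, |v' ω| ≤ C)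
    (h1 : ∫ ω, |u ω - u' ω| ∂μ ≤ ε) (h2 : ∫ ω, |v ω - v' ω| ∂μ ≤ ε) :
    |(∫ ω, u ω * v ω ∂μ - (∫ ω, u ω ∂μ) * ∫ ω, v ω ∂μ)
      - (∫ ω, u' ω * v' ω ∂μ - (∫ ω, u' ω ∂μ) * ∫ ω, v' ω ∂μ)| ≤ 4 * C * ε := by
  have hint {w : Ω → ℝ} (hw : Measurable w) {D : ℝ} (hD : ∀ ω, |w ω| ≤ D) : Integrable w μ :=
    Integrable.of_bound hw.aestronglyMeasurable D (ae_of_all _ hD)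
  have hC : 0 ≤ C := by
    obtain ⟨ω⟩ := nonempty_of_isProbabilityMeasure μ
    exact (abs_nonneg _).trans (huC ω)
  have hmul {w z : Ω → ℝ} (hw : Measurable w) (hz : Measurable z) (hwC : ∀ ω, |w ω| ≤ C)
      (hzC : ∀ ω, |z ω| ≤ C) : Integrable (fun ω => w ω * z ω) μ :=
    hint (hw.mul hz) (D := C * C) fun ω => by
      rw [abs_mul]; exact mul_le_mul (hwC ω) (hzC ω) (abs_nonneg _) hC
  have habs {w : Ω → ℝ} (hw : Measurable w) (hwC : ∀ ω, |w ω| ≤ C) : |∫ ω, w ω ∂μ| ≤ C := by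
    simpa using norm_integral_le_of_norm_le_const (μ := μ) (f := w) (ae_of_all _ hwC)
  have iu := hint hu huC
  have iv := hint hv hvC
  have iu' := hint hu' huC'
  have iv' := hint hv' hvC'
  have e1 : |∫ ω, u ω * v ω ∂μ - ∫ ω, u' ω * v' ω ∂μ| ≤ C * ε + C * ε := by
    rw [← integral_sub (hmul hu hv huC hvC) (hmul hu' hv' huC' hvC')]
    calc _ ≤ ∫ ω, |u ω * v ω - u' ω * v' ω| ∂μ := abs_integral_le_integral_abs
      _ ≤ ∫ ω, C * |u ω - u' ω| + C * |v ω - v' ω| ∂μ := by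
        refine integral_mono ((hmul hu hv huC hvC).sub (hmul hu' hv' huC' hvC')).abs
          (((iu.sub iu').abs.const_mul C).add ((iv.sub iv').abs.const_mul C)) fun ω => ?_
        have : u ω * v ω - u' ω * v' ω = v ω * (u ω - u' ω) + u' ω * (v ω - v' ω) := by ring
        dsimp only
        rw [this]
        refine (abs_add_le _ _).trans ?_
        rw [abs_mul, abs_mul]
        gcongr
        exacts [hvC ω, huC' ω]
      _ = C * ∫ ω, |u ω - u' ω| ∂μ + C * ∫ ω, |v ω - v' ω| ∂μ := by
        rw [← integral_const_mul, ← integral_const_mul]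
        exact integral_add ((iu.sub iu').abs.const_mul C) ((iv.sub iv').abs.const_mul C)
      _ ≤ _ := by gcongr
  have e2 : |(∫ ω, u ω ∂μ) * (∫ ω, v ω ∂μ) - (∫ ω, u' ω ∂μ) * ∫ ω, v' ω ∂μ|
      ≤ C * ε + C * ε := by
    have d1 : |∫ ω, u ω ∂μ - ∫ ω, u' ω ∂μ| ≤ ε := by
      rw [← integral_sub iu iu']; exact abs_integral_le_integral_abs.trans h1
    have d2 : |∫ ω, v ω ∂μ - ∫ ω, v' ω ∂μ| ≤ ε := by
      rw [← integral_sub iv iv']; exact abs_integral_le_integral_abs.trans h2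
    have : (∫ ω, u ω ∂μ) * (∫ ω, v ω ∂μ) - (∫ ω, u' ω ∂μ) * ∫ ω, v' ω ∂μ =
        (∫ ω, v ω ∂μ) * (∫ ω, u ω ∂μ - ∫ ω, u' ω ∂μ)
          + (∫ ω, u' ω ∂μ) * (∫ ω, v ω ∂μ - ∫ ω, v' ω ∂μ) := by ring
    rw [this]
    refine (abs_add_le _ _).trans ?_
    rw [abs_mul, abs_mul]
    gcongr
    exacts [habs hv hvC, habs hu' huC']
  rw [abs_le] at *
  constructor <;> linarith [e1.1, e1.2, e2.1, e2.2]

/-- Simultaneous approximation of `f(X_J)` and `g(X_K)` by bounded monotone functions of finitely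
many coordinates, up to an arbitrarily small error in the covariance. -/
theorem exists_monotone_restrict_cov_approx {I Ω E : Type*} [Countable I]
    [TopologicalSpace E] [PolishSpace E] [MeasurableSpace E] [BorelSpace E]
    [PartialOrder E] [OrderClosedTopology E]
    [MeasurableSpace Ω] (μ : Measure Ω) [IsProbabilityMeasure μ]
    {X : I → Ω → E} (hX : ∀ i, Measurable (X i)) {J K : Set I} {f : (J → E) → ℝ} {g : (K → E) → ℝ}
    (hf : Measurable f) (hfm : Monotone f) (hfb : ∃ C : ℝ, ∀ x, |f x| ≤ C)
    (hg : Measurable g) (hgm : Monotone g) (hgb : ∃ C : ℝ, ∀ x, |g x| ≤ C)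
    {ε : ℝ} (hε : 0 < ε) :
    ∃ (F : Finset J) (f' : (F → E) → ℝ) (G : Finset K) (g' : (G → E) → ℝ),
      (Measurable f' ∧ Monotone f' ∧ ∃ C : ℝ, ∀ x, |f' x| ≤ C) ∧
      (Measurable g' ∧ Monotone g' ∧ ∃ C : ℝ, ∀ x, |g' x| ≤ C) ∧
      |(∫ ω, f (fun j => X j ω) * g (fun k => X k ω) ∂μ
          - (∫ ω, f (fun j => X j ω) ∂μ) * ∫ ω, g (fun k => X k ω) ∂μ)
        - (∫ ω, f' (fun j => X j.1 ω) * g' (fun k => X k.1 ω) ∂μ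
          - (∫ ω, f' (fun j => X j.1 ω) ∂μ) * ∫ ω, g' (fun k => X k.1 ω) ∂μ)| ≤ ε := by
  obtain ⟨C₁, hC₁⟩ := hfb
  obtain ⟨C₂, hC₂⟩ := hgb
  let C := max 1 (max C₁ C₂)
  have hC : 0 < C := lt_max_of_lt_left one_pos
  have hfC (x) : |f x| ≤ C := (hC₁ x).trans (by simp [C])
  have hgC (x) : |g x| ≤ C := (hC₂ x).trans (by simp [C])
  have key {L : Set I} {p : (L → E) → ℝ} (hp : Measurable p) (hpm : Monotone p)
      (hpC : ∀ x, |p x| ≤ C) :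
      ∃ (F : Finset L) (q : (F → E) → ℝ), Measurable q ∧ Monotone q ∧ (∀ y, |q y| ≤ C) ∧
        ∫ ω, |p (fun j => X j ω) - q (fun j => X j.1 ω)| ∂μ ≤ ε / (4 * C) := by
    have hXL : Measurable fun ω (j : L) => X j ω := measurable_pi_lambda _ fun j => hX j
    have : IsProbabilityMeasure (μ.map fun ω (j : L) => X j ω) :=
      Measure.isProbabilityMeasure_map hXL.aemeasurable
    obtain ⟨F, q, hq, hqm, hqC, hle⟩ := exists_monotone_restrict_integral_abs_sub_le
      (μ.map fun ω (j : L) => X j ω) hp hpm hC hpC (ε := ε / (4 * C)) (by positivity)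
    have hmap := integral_map (μ := μ) hXL.aemeasurable
      (hp.sub (hq.comp F.measurable_restrict)).abs.aestronglyMeasurable
    exact ⟨F, q, hq, hqm, hqC, hmap.symm.trans_le hle⟩
  obtain ⟨F, f', hf', hfm', hfC', h1⟩ := key hf hfm hfC
  obtain ⟨G, g', hg', hgm', hgC', h2⟩ := key hg hgm hgC
  refine ⟨F, f', G, g', ⟨hf', hfm', C, hfC'⟩, ⟨hg', hgm', C, hgC'⟩, ?_⟩
  have := abs_cov_sub_cov_le μ
    (hf.comp (measurable_pi_lambda _ fun j => hX j)) (hg.comp (measurable_pi_lambda _ fun j => hX j))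
    (hf'.comp (measurable_pi_lambda _ fun j => hX j.1))
    (hg'.comp (measurable_pi_lambda _ fun j => hX j.1))
    (fun _ => hfC _) (fun _ => hgC _) (fun _ => hfC' _) (fun _ => hgC' _) h1 h2
  rwa [mul_div_cancel₀ _ (by positivity)] at this

/-- If all finite subfamilies of a countable family of random elements of a Polish space with a closed
partial order are negatively (respectively positively) associated, then so is the whole family. -/
theorem theorem3p3 {I Ω E : Type*} [Countable I]
    [TopologicalSpace E] [PolishSpace E] [MeasurableSpace E] [BorelSpace E]
    [PartialOrder E] [OrderClosedTopology E]
    [MeasurableSpace Ω] (μ : Measure Ω) [IsProbabilityMeasure μ]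
    (X : I → Ω → E) (hX : ∀ i, Measurable (X i)) :
    ((∀ J : Set I, J.Finite → NegativelyAssociated μ (fun (j : J) => X j)) →
        NegativelyAssociated μ X) ∧
    ((∀ J : Set I, J.Finite → PositivelyAssociated μ (fun (j : J) => X j)) →
        PositivelyAssociated μ X) := by
  classical
  refine ⟨fun hfin J f g hf hfm hfb hg hgm hgb => ?_, fun hfin J f g hf hfm hfb hg hgm hgb => ?_⟩
  · rw [← sub_nonpos]
    refine le_of_forall_pos_le_add fun ε hε => ?_
    obtain ⟨F, f', G, g', ⟨hf', hfm', C, hfC⟩, ⟨hg', hgm', D, hgD⟩, happ⟩ :=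
      exists_monotone_restrict_cov_approx μ hX hf hfm hfb hg hgm hgb hε
    let S : Set I := {i | (∃ j ∈ F, j.1 = i) ∨ ∃ k ∈ G, k.1 = i}
    have hS : S.Finite := (F.finite_toSet.image Subtype.val).union (G.finite_toSet.image Subtype.val)
    -- The indices of `f'` lie in `J` and those of `g'` do not, so `S ∩ J` separates them within `S`.
    have := hfin S hS {s | s.1 ∈ J}
      (fun y => f' fun j => y ⟨⟨j.1.1, Or.inl ⟨j.1, j.2, rfl⟩⟩, j.1.2⟩)
      (fun y => g' fun k => y ⟨⟨k.1.1, Or.inr ⟨k.1, k.2, rfl⟩⟩, k.1.2⟩)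
      (hf'.comp (by fun_prop)) (fun y z hyz => hfm' fun j => hyz _) ⟨C, fun _ => hfC _⟩
      (hg'.comp (by fun_prop)) (fun y z hyz => hgm' fun j => hyz _) ⟨D, fun _ => hgD _⟩
    dsimp only at this
    linarith [(abs_le.mp happ).2]
  · rw [← sub_nonneg]
    refine le_of_forall_pos_sub_le fun ε hε => ?_
    obtain ⟨F, f', G, g', ⟨hf', hfm', C, hfC⟩, ⟨hg', hgm', D, hgD⟩, happ⟩ :=
      exists_monotone_restrict_cov_approx μ hX hf hfm hfb hg hgm hgb hε
    let S : Set I := {i | (∃ j ∈ F, j.1 = i) ∨ ∃ k ∈ G, k.1 = i}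
    have hS : S.Finite := (F.finite_toSet.image Subtype.val).union (G.finite_toSet.image Subtype.val)
    have := hfin S hS univ
      (fun y => f' fun j => y ⟨⟨j.1.1, Or.inl ⟨j.1, j.2, rfl⟩⟩, mem_univ _⟩)
      (fun y => g' fun k => y ⟨⟨k.1.1, Or.inr ⟨k.1, k.2, rfl⟩⟩, mem_univ _⟩)
      (hf'.comp (by fun_prop)) (fun y z hyz => hfm' fun j => hyz _) ⟨C, fun _ => hfC _⟩
      (hg'.comp (by fun_prop)) (fun y z hyz => hgm' fun j => hyz _) ⟨D, fun _ => hgD _⟩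
    dsimp only at this
    linarith [(abs_le.mp happ).1]
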